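/- Let $H$ be a real Hilbert space and let $W=(W(h))_{h\in H}$ be an isonormal process on a probability space $(\Omega,\mathcal F,P)$, i.e. a centered Gaussian family with $E[W(h)W(k)]=\langle h,k\rangle_H$ for all $h,k\in H$. For $n\ge 0$ let $I_n$ denote the multiple Wiener–Itô integral of order $n$, i.e. the continuous linear map from the symmetric tensors of the Hilbert tensor power $H^{\otimes n}$ to $L^2(\Omega)$ with $I_n(h^{\otimes n})=H_n(W(h))$ for $\|h\|=1$, where $H_n$ is the monic (probabilists') Hermite polynomial of degree $n$. Let $D$ be the Malliavin derivative, i.e. the closure in $L^2(\Omega)\times L^2(\Omega;H)$ of $p(W(x_1),\dots,W(x_k))\mapsto\sum_i \partial_i p(W(x_1),\dots,W(x_k))\,x_i$ ($p$ a polynomial). For a random vector $(F,G)$ write $$\Lambda=\begin{pmatrix}\|DF\|_H^2&\langle DF,DG\rangle_H\\ \langle DF,DG\rangle_H&\|DG\|_H^2\end{pmatrix},\qquad C=\begin{pmatrix}\mathrm{Var}(F)&\mathrm{Cov}(F,G)\\ \mathrm{Cov}(F,G)&\mathrm{Var}(G)\end{pmatrix}$$ for its Malliavin matrix and its covariance matrix.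 Fix $h\in H$ with $\|h\|=1$. (1) If $F=I_1(h)$ and $G=I_2(h^{\otimes 2})$, then $\det C=2$ and $\det\Lambda=0$ almost surely. (2) More generally, let $n,m\ge 1$ with $n\ne m$, and let $F=I_n(h^{\otimes n})$, $G=I_m(h^{\otimes m})$. Then $F$ and $G$ are in the domain of $D$, $\det\Lambda=0$ almost surely, and $\det C=n!\,m!\neq 0$. The law of $(F,G)$ is not absolutely continuous with respect to Lebesgue measure on $\mathbb R^2$, and $F$ and $G$ are not proportional: no relation $aF+bG=0$ almost surely holds with $(a,b)\ne(0,0)$. Thus the dichotomy "either the vector has a density or its components are proportional" fails for chaoses of different orders. -/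

import Mathlib

open MeasureTheory ProbabilityTheory
open scoped TensorProduct RealInnerProductSpace ENNReal

namespace WienerChaos

section HilbertTensorPower

variable (H : Type*) [NormedAddCommGroup H] [InnerProductSpace ℝ H] (n : ℕ)

/-- The bilinear form on the algebraic tensor power with
`⟨x₁ ⊗ ⋯ ⊗ xₙ, y₁ ⊗ ⋯ ⊗ yₙ⟩ = ∏ᵢ ⟨xᵢ, yᵢ⟩`. -/
noncomputable def tensorForm :
    (⨂[ℝ] (_ : Fin n), H) →ₗ[ℝ] Module.Dual ℝ (⨂[ℝ] (_ : Fin n), H) :=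
  (PiTensorProduct.dualDistrib (R := ℝ) (M := fun _ : Fin n => H)) ∘ₗ
    (PiTensorProduct.map (fun _ : Fin n => innerₗ H))

variable {H n}

theorem tensorForm_tprod (x y : Fin n → H) :
    tensorForm H n (PiTensorProduct.tprod ℝ x) (PiTensorProduct.tprod ℝ y) =
      ∏ i, ⟪x i, y i⟫ := by
  unfold tensorForm
  rw [LinearMap.comp_apply, PiTensorProduct.map_tprod, PiTensorProduct.dualDistrib_apply]
  rfl

theorem exists_sum_tprod (t : ⨂[ℝ] (_ : Fin n), H) :
    ∃ c : (Fin n → H) →₀ ℝ, (c.sum fun x a => a • PiTensorProduct.tprod ℝ x) = t := by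
  have h : t ∈ Submodule.span ℝ
      (Set.range (PiTensorProduct.tprod ℝ (s := fun _ : Fin n => H))) := by
    rw [PiTensorProduct.span_tprod_eq_top]; trivial
  exact (Finsupp.mem_span_range_iff_exists_finsupp).1 h

theorem tensorForm_sum (c d : (Fin n → H) →₀ ℝ) :
    tensorForm H n (c.sum fun x a => a • PiTensorProduct.tprod ℝ x)
        (d.sum fun x a => a • PiTensorProduct.tprod ℝ x) =
      ∑ x ∈ c.support, ∑ y ∈ d.support, c x * (d y * ∏ i, ⟪x i, y i⟫) := by
  simp only [Finsupp.sum, map_sum, map_smul, LinearMap.sum_apply, LinearMap.smul_apply,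
    tensorForm_tprod, smul_eq_mul, Finset.mul_sum]
  rw [Finset.sum_comm]
  refine Finset.sum_congr rfl fun x _ => Finset.sum_congr rfl fun y _ => ?_
  ring

theorem tensorForm_symm (s t : ⨂[ℝ] (_ : Fin n), H) :
    tensorForm H n s t = tensorForm H n t s := by
  obtain ⟨c, rfl⟩ := exists_sum_tprod s
  obtain ⟨d, rfl⟩ := exists_sum_tprod t
  rw [tensorForm_sum, tensorForm_sum, Finset.sum_comm]
  refine Finset.sum_congr rfl fun x _ => Finset.sum_congr rfl fun y _ => ?_
  rw [Finset.prod_congr rfl fun i _ => real_inner_comm (x i) (y i)]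
  ring

theorem tensorForm_self_nonneg (t : ⨂[ℝ] (_ : Fin n), H) : 0 ≤ tensorForm H n t t := by
  obtain ⟨c, rfl⟩ := exists_sum_tprod t
  have key : ∀ s : Finset (Fin n),
      (Matrix.of fun (x y : c.support) => ∏ i ∈ s, ⟪x.1 i, y.1 i⟫ : Matrix _ _ ℝ).PosSemidef := by
    intro s
    induction s using Finset.induction_on with
    | empty =>
      have e : (Matrix.of fun (x y : c.support) => ∏ i ∈ ∅, ⟪x.1 i, y.1 i⟫ : Matrix _ _ ℝ) =
          Matrix.gram ℝ (fun _ : c.support => (1 : ℝ)) := by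
        ext x y
        simp [Matrix.gram_apply]
      rw [e]
      exact Matrix.posSemidef_gram (𝕜 := ℝ) (fun _ : c.support => (1 : ℝ))
    | insert a s ha ih =>
      have e : (Matrix.of fun (x y : c.support) => ∏ i ∈ insert a s, ⟪x.1 i, y.1 i⟫ :
          Matrix _ _ ℝ) = (Matrix.gram ℝ (fun x : c.support => x.1 a)).hadamard
            (Matrix.of fun (x y : c.support) => ∏ i ∈ s, ⟪x.1 i, y.1 i⟫) := by
        ext x y
        simp [Matrix.gram_apply, Finset.prod_insert ha]
      rw [e]
      exact (Matrix.posSemidef_gram (𝕜 := ℝ) (fun x : c.support => x.1 a)).hadamard ih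
  have h := (key Finset.univ).dotProduct_mulVec_nonneg (fun x : c.support => c x.1)
  rw [tensorForm_sum, ← Finset.sum_coe_sort]
  refine h.trans_eq ?_
  simp only [dotProduct, Matrix.mulVec, Finset.mul_sum, Matrix.of_apply]
  refine Finset.sum_congr rfl fun x _ => ?_
  rw [← Finset.sum_coe_sort c.support]
  refine Finset.sum_congr rfl fun y _ => ?_
  simp only [star_trivial]
  ring

variable (H n)

/-- The algebraic `n`-fold tensor power of `H`. (A separate name, because Mathlib puts the
projective seminorm on `⨂[ℝ] _, H`, and here the Hilbert norm is wanted.) -/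
def AlgTensorPower : Type _ := ⨂[ℝ] (_ : Fin n), H

noncomputable instance : AddCommGroup (AlgTensorPower H n) :=
  inferInstanceAs (AddCommGroup (⨂[ℝ] (_ : Fin n), H))

noncomputable instance : Module ℝ (AlgTensorPower H n) :=
  inferInstanceAs (Module ℝ (⨂[ℝ] (_ : Fin n), H))

variable {H n}

/-- The elementary tensor `x₁ ⊗ ⋯ ⊗ xₙ`. -/
noncomputable def algTprod (x : Fin n → H) : AlgTensorPower H n :=
  PiTensorProduct.tprod ℝ x

variable (H n)

/-- The (pre-)inner product on the algebraic tensor power. -/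
@[reducible]
noncomputable def tensorCore : PreInnerProductSpace.Core ℝ (AlgTensorPower H n) where
  inner s t := tensorForm H n s t
  conj_inner_symm s t := by simpa using tensorForm_symm t s
  re_inner_nonneg t := by simpa using tensorForm_self_nonneg t
  add_left s t u := LinearMap.congr_fun ((tensorForm H n).map_add s t) u
  smul_left s t r := LinearMap.congr_fun ((tensorForm H n).map_smul r s) t

noncomputable instance : SeminormedAddCommGroup (AlgTensorPower H n) :=
  @InnerProductSpace.Core.toSeminormedAddCommGroup ℝ (AlgTensorPower H n) _ _ _ (tensorCore H n)

noncomputable instance : InnerProductSpace ℝ (AlgTensorPower H n) :=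
  InnerProductSpace.ofCore (tensorCore H n)

/-- The Hilbert space tensor power `H^{⊗ n}`: the Hilbert completion of the algebraic tensor
power. -/
abbrev HilbertTensorPower : Type _ := UniformSpace.Completion (AlgTensorPower H n)

variable {H}

/-- The tensor power `h^{⊗ n}` of a vector. -/
noncomputable def tensorPow (h : H) : HilbertTensorPower H n :=
  ((algTprod fun _ : Fin n => h : AlgTensorPower H n) : HilbertTensorPower H n)

/-- The inner product of `H^{⊗ n}` has its usual values on tensor powers. -/
theorem inner_tensorPow (h k : H) :
    ⟪tensorPow n h, tensorPow n k⟫ = ⟪h, k⟫ ^ n := by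
  unfold tensorPow
  rw [UniformSpace.Completion.inner_coe]
  refine (tensorForm_tprod _ _).trans ?_
  simp

end HilbertTensorPower

section Chaos

variable {Ω : Type*} [MeasurableSpace Ω] {H : Type*} [NormedAddCommGroup H]
  [InnerProductSpace ℝ H]

/-- `W = (W(h))_{h ∈ H}` is an isonormal process on `(Ω, P)`: a centered Gaussian family with
`E[W(h) W(k)] = ⟨h, k⟩`. -/
structure IsIsonormal (W : H → Ω → ℝ) (P : Measure Ω) : Prop where
  gaussian : IsGaussianProcess W P
  centered : ∀ h, ∫ ω, W h ω ∂P = 0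
  covariance : ∀ h k, ∫ ω, W h ω * W k ω ∂P = ⟪h, k⟫

/-- The graph of the multiple Wiener–Itô integral `Iₙ` of the process `W`, as a subspace of
`H^{⊗ n} × L²(P)`: the closed linear span of the pairs `(h^{⊗ n}, Hₙ(W(h)))`, `‖h‖ = 1`, where `Hₙ`
is the monic (probabilists') Hermite polynomial. Its domain is the space of symmetric tensors. -/
noncomputable def multipleIntegralGraph (W : H → Ω → ℝ) (P : Measure Ω) (n : ℕ) :
    Submodule ℝ (HilbertTensorPower H n × Lp ℝ 2 P) :=
  (Submodule.span ℝ {q | ∃ h : H, ‖h‖ = 1 ∧ q.1 = tensorPow n h ∧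
    q.2 =ᵐ[P] fun ω => Polynomial.aeval (W h ω) (Polynomial.hermite n)}).topologicalClosure

/-- The multiple Wiener–Itô integral `Iₙ(f) ∈ L²(P)` of a symmetric `f ∈ H^{⊗ n}`
(and `0` if `f` is not in the domain). -/
noncomputable def multipleIntegral (W : H → Ω → ℝ) (P : Measure Ω) (n : ℕ)
    (f : HilbertTensorPower H n) : Lp ℝ 2 P :=
  open Classical in
  if hf : ∃ F, (f, F) ∈ multipleIntegralGraph W P n then hf.choose else 0

/-- The graph of the Malliavin derivative `D`, as a subspace of `L²(P) × L²(P; H)`: the closure of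
the operator `p(W(x₁), …, W(x_k)) ↦ ∑ᵢ ∂ᵢp(W(x₁), …, W(x_k)) xᵢ` on polynomial cylindrical random
variables. -/
noncomputable def malliavinGraph (W : H → Ω → ℝ) (P : Measure Ω) :
    Submodule ℝ (Lp ℝ 2 P × Lp H 2 P) :=
  (Submodule.span ℝ {q | ∃ (k : ℕ) (x : Fin k → H) (p : MvPolynomial (Fin k) ℝ),
    (q.1 =ᵐ[P] fun ω => MvPolynomial.eval (fun i => W (x i) ω) p) ∧
    (q.2 =ᵐ[P] fun ω => ∑ i, MvPolynomial.eval (fun j => W (x j) ω) (MvPolynomial.pderiv i p) • x i)}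
    ).topologicalClosure

/-- `F` is in the domain of the Malliavin derivative. -/
def IsMalliavinDifferentiable (W : H → Ω → ℝ) (P : Measure Ω) (F : Lp ℝ 2 P) : Prop :=
  ∃ U, (F, U) ∈ malliavinGraph W P

/-- The Malliavin derivative `DF ∈ L²(P; H)` (and `0` if `F` is not in the domain). -/
noncomputable def malliavinDeriv (W : H → Ω → ℝ) (P : Measure Ω) (F : Lp ℝ 2 P) : Lp H 2 P :=
  open Classical in
  if hF : IsMalliavinDifferentiable W P F then hF.choose else 0

/-- The Malliavin matrix `Λ` of the random vector `(F, G)`. -/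
noncomputable def malliavinMatrix (W : H → Ω → ℝ) (P : Measure Ω) (F G : Lp ℝ 2 P) (ω : Ω) :
    Matrix (Fin 2) (Fin 2) ℝ :=
  !![⟪malliavinDeriv W P F ω, malliavinDeriv W P F ω⟫,
      ⟪malliavinDeriv W P F ω, malliavinDeriv W P G ω⟫;
    ⟪malliavinDeriv W P G ω, malliavinDeriv W P F ω⟫,
      ⟪malliavinDeriv W P G ω, malliavinDeriv W P G ω⟫]

/-- The covariance matrix `C` of the random vector `(F, G)`. -/
noncomputable def covMatrix (P : Measure Ω) (F G : Lp ℝ 2 P) : Matrix (Fin 2) (Fin 2) ℝ :=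
  !![cov[F, F; P], cov[F, G; P]; cov[G, F; P], cov[G, G; P]]

/-- The random vector `(F, G)` admits a density: its law is absolutely continuous with respect to
Lebesgue measure on `ℝ²`. -/
def HasJointDensity (P : Measure Ω) (F G : Lp ℝ 2 P) : Prop :=
  P.map (fun ω => (F ω, G ω)) ≪ (volume : Measure (ℝ × ℝ))

/-- `F` and `G` are proportional: they satisfy a nontrivial linear relation. -/
def AreProportional (P : Measure Ω) (F G : Lp ℝ 2 P) : Prop :=
  ∃ a b : ℝ, (a ≠ 0 ∨ b ≠ 0) ∧ a • F + b • G = 0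

end Chaos

end WienerChaos

namespace WienerChaos

/-! ### Integration by parts for a standard Gaussian variable -/

section Stein

/-! Both components are polynomials in one Gaussian variable: `F = Hₙ(W h)` and `G = Hₘ(W h)`. Hence
`DF` and `DG` are pointwise multiples of `h` and their Gram determinant vanishes. The vector `(F,
G)` lives on a polynomial curve, which is Lebesgue null. Hermite orthogonality gives the covariance
matrix `diag(n!, m!)` and rules out a linear relation.

The work lies in showing that the operators, defined by choice from closed graphs, take these
values, that is, that the graphs are single-valued. For `Iₙ` this follows from the isometry
`inner_of_mem_multipleIntegralGraph`, for `D` from closability, `eq_zero_of_mem_malliavinGraph`.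
Both rest on Gaussian integration by parts, `integral_mul_eval`, proved by splitting `W x` into `⟪x,
g⟫ W g` and a residual independent of `W g`. -/

/-- Hölder with exponents `2r, 2r` loses integrability, so only the class of functions with all
finite moments is stable under products. -/
theorem memLp_mul_of_forall {Ω : Type*} [MeasurableSpace Ω] {P : Measure Ω}
    {f g : Ω → ℝ} (hf : ∀ r : ℝ≥0∞, r ≠ ∞ → MemLp f r P)
    (hg : ∀ r : ℝ≥0∞, r ≠ ∞ → MemLp g r P) :
    ∀ r : ℝ≥0∞, r ≠ ∞ → MemLp (fun ω => f ω * g ω) r P := by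
  intro r hr
  have h2 : (2 * r : ℝ≥0∞) ≠ ∞ := ENNReal.mul_ne_top (by simp) hr
  have : ENNReal.HolderTriple (2 * r) (2 * r) r := ⟨by
    rw [ENNReal.mul_inv (by simp) (by simp), ← add_mul, ENNReal.inv_two_add_inv_two, one_mul]⟩
  exact (hg _ h2).mul' (hf _ h2)

theorem memLp_mvPolynomial_eval {Ω ι : Type*} [MeasurableSpace Ω] {P : Measure Ω}
    [IsFiniteMeasure P] {V : ι → Ω → ℝ} (hV : ∀ i, ∀ r : ℝ≥0∞, r ≠ ∞ → MemLp (V i) r P)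
    (p : MvPolynomial ι ℝ) : ∀ r : ℝ≥0∞, r ≠ ∞ →
      MemLp (fun ω => MvPolynomial.eval (fun i => V i ω) p) r P := by
  induction p using MvPolynomial.induction_on with
  | C a => intro r _; simpa using memLp_const a
  | add p q hp hq => intro r hr; simpa using! (hp r hr).add (hq r hr)
  | mul_X p i hp =>
    simpa only [map_mul, MvPolynomial.eval_X] using! memLp_mul_of_forall hp (hV i)

theorem measurable_mvPolynomial_eval {ι : Type*} (p : MvPolynomial ι ℝ) :
    Measurable fun x : ι → ℝ => MvPolynomial.eval x p := by
  induction p using MvPolynomial.induction_on with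
  | C a => simp
  | add p q hp hq => simpa using! hp.add hq
  | mul_X p i hp => simpa using! hp.mul (measurable_pi_apply i)

theorem mvPolynomial_eval_aeval {ι : Type*} (x : ι → ℝ) (p : MvPolynomial ι ℝ)
    (q : Polynomial ℝ) :
    MvPolynomial.eval x (Polynomial.aeval p q) = q.eval (MvPolynomial.eval x p) := by
  have h := Polynomial.aeval_algHom_apply (MvPolynomial.aeval (R := ℝ) x) p q
  rw [MvPolynomial.aeval_eq_eval] at h
  simpa [Polynomial.coe_aeval_eq_eval] using h.symm

theorem memLp_polynomial_eval_gaussianReal (q : Polynomial ℝ) (r : ℝ≥0∞) (hr : r ≠ ∞) :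
    MemLp (fun x : ℝ => q.eval x) r (gaussianReal 0 1) := by
  have h := memLp_mvPolynomial_eval (P := gaussianReal 0 1) (V := fun _ : Unit => (id : ℝ → ℝ))
    (fun _ r hr => memLp_id_gaussianReal' r hr) (Polynomial.aeval (MvPolynomial.X ()) q) r hr
  simpa [mvPolynomial_eval_aeval] using h

/-- With `φ` the Gaussian density, `φ' = -xφ`, so `(φq)' = φq' - xφq`; an integrable derivative of
an integrable function on the line has integral zero. -/
theorem integral_mul_polynomial_gaussianReal (q : Polynomial ℝ) :
    ∫ x, x * q.eval x ∂gaussianReal 0 1 = ∫ x, q.derivative.eval x ∂gaussianReal 0 1 := by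
  have hi : ∀ q : Polynomial ℝ, Integrable (fun x => gaussianPDFReal 0 1 x * q.eval x) := by
    intro q
    have h := (memLp_polynomial_eval_gaussianReal q 1 (by simp)).integrable le_rfl
    rw [gaussianReal_of_var_ne_zero _ one_ne_zero,
      integrable_withDensity_iff_integrable_smul' (measurable_gaussianPDF _ _)
        (.of_forall fun x => gaussianPDF_lt_top)] at h
    simpa [toReal_gaussianPDF] using h
  have hd : ∀ x, HasDerivAt (fun x => gaussianPDFReal 0 1 x * q.eval x)
      (gaussianPDFReal 0 1 x * q.derivative.eval x -
        gaussianPDFReal 0 1 x * (Polynomial.X * q).eval x) x := by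
    intro x
    have h1 : HasDerivAt (gaussianPDFReal 0 1) (-x * gaussianPDFReal 0 1 x) x := by
      rw [gaussianPDFReal_def]
      have h2 : HasDerivAt (fun x : ℝ => -(x - 0) ^ 2 / (2 * ((1 : NNReal) : ℝ))) (-x) x := by
        have := ((((hasDerivAt_id x).sub_const 0).pow 2).neg).div_const (2 * ((1 : NNReal) : ℝ))
        convert! this using 1
        simp; ring
      convert! (h2.exp.const_mul _) using 1
      ring
    convert! h1.mul (q.hasDerivAt x) using 1
    simp; ring
  have h0 := integral_eq_zero_of_hasDerivAt_of_integrable hd ((hi _).sub (hi _)) (hi _)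
  rw [integral_sub (hi _) (hi _)] at h0
  rw [integral_gaussianReal_eq_integral_smul one_ne_zero,
    integral_gaussianReal_eq_integral_smul one_ne_zero]
  simp only [smul_eq_mul]
  simp only [Polynomial.eval_mul, Polynomial.eval_X] at h0
  linarith

variable {Ω ι : Type*} [MeasurableSpace Ω] {P : Measure Ω}

/-- Gaussian integration by parts in a standard Gaussian variable `Z` that is independent of the
other variables `Y`. -/
theorem integral_mul_eval₂_of_indepFun [IsProbabilityMeasure P] {Y : ι → Ω → ℝ} {Z : Ω → ℝ}
    (hY : ∀ i, ∀ r : ℝ≥0∞, r ≠ ∞ → MemLp (Y i) r P)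
    (hZm : AEMeasurable Z P) (hZ : P.map Z = gaussianReal 0 1)
    (hind : IndepFun (fun ω i => Y i ω) Z P) (q : Polynomial (MvPolynomial ι ℝ)) :
    ∫ ω, Z ω * q.eval₂ (MvPolynomial.eval fun i => Y i ω) (Z ω) ∂P =
      ∫ ω, q.derivative.eval₂ (MvPolynomial.eval fun i => Y i ω) (Z ω) ∂P := by
  have hq : ∀ (u : Polynomial ℝ) (r : ℝ≥0∞), r ≠ ∞ → MemLp (fun ω => u.eval (Z ω)) r P := by
    intro u r hr
    have h := memLp_polynomial_eval_gaussianReal u r hr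
    rw [← hZ] at h
    exact h.comp_of_map hZm
  have hB := memLp_mvPolynomial_eval hY
  have hBu : ∀ (B : MvPolynomial ι ℝ) (u : Polynomial ℝ),
      Integrable (fun ω => MvPolynomial.eval (fun i => Y i ω) B * u.eval (Z ω)) P := fun B u =>
    (memLp_mul_of_forall (hB B) (hq u) 1 (by simp)).integrable le_rfl
  have hint : ∀ (B : MvPolynomial ι ℝ) (u : Polynomial ℝ),
      ∫ ω, MvPolynomial.eval (fun i => Y i ω) B * u.eval (Z ω) ∂P =
        (∫ ω, MvPolynomial.eval (fun i => Y i ω) B ∂P) * ∫ x, u.eval x ∂gaussianReal 0 1 := by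
    intro B u
    have h := (hind.comp (measurable_mvPolynomial_eval B)
      (u.continuous.measurable)).integral_fun_mul_eq_mul_integral
      (hB B 1 (by simp)).aestronglyMeasurable (hq u 1 (by simp)).aestronglyMeasurable
    rw [← hZ, integral_map hZm u.continuous.aestronglyMeasurable]
    exact h
  have hmon : ∀ (n : ℕ) (B : MvPolynomial ι ℝ),
      Integrable (fun ω => Polynomial.eval₂ (MvPolynomial.eval fun i => Y i ω) (Z ω)
        (Polynomial.monomial n B)) P := by
    intro n B
    simpa [Polynomial.eval₂_monomial] using hBu B (Polynomial.X ^ n)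
  have hall : ∀ q : Polynomial (MvPolynomial ι ℝ),
      Integrable (fun ω => q.eval₂ (MvPolynomial.eval fun i => Y i ω) (Z ω)) P := by
    intro q
    induction q using Polynomial.induction_on' with
    | add p q hp hq => simpa [Polynomial.eval₂_add] using! hp.add hq
    | monomial n B => exact hmon n B
  have hallZ : ∀ q : Polynomial (MvPolynomial ι ℝ),
      Integrable (fun ω => Z ω * q.eval₂ (MvPolynomial.eval fun i => Y i ω) (Z ω)) P := by
    intro q
    refine (hall (Polynomial.X * q)).congr (.of_forall fun ω => ?_)
    simp [Polynomial.eval₂_mul]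
  induction q using Polynomial.induction_on' with
  | add p q hp hq =>
    simp only [Polynomial.derivative_add, Polynomial.eval₂_add, mul_add]
    rw [integral_add (hallZ p) (hallZ q), integral_add (hall _) (hall _), hp, hq]
  | monomial n B =>
    -- For a single monomial in `Z`, independence pulls out the coefficient `B(Y)` and the
    -- one-variable formula applies to `Zⁿ`.
    have h1 := hint B (Polynomial.X * Polynomial.X ^ n)
    have h2 := hint B (Polynomial.derivative (Polynomial.X ^ n))
    have h3 := integral_mul_polynomial_gaussianReal (Polynomial.X ^ n)
    simp only [Polynomial.eval_mul, Polynomial.eval_X] at h1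
    rw [h3, ← h2] at h1
    simp only [Polynomial.derivative_monomial, Polynomial.eval₂_monomial]
    convert h1 using 2
    · ext ω; simp; ring
    · ext ω; simp [Polynomial.derivative_X_pow]; ring

end Stein

/-! ### Integration by parts for an isonormal process -/

section Isonormal

variable {Ω : Type*} [MeasurableSpace Ω] {P : Measure Ω} {H : Type*} [NormedAddCommGroup H]
  [InnerProductSpace ℝ H] {W : H → Ω → ℝ}

/-- The derivation of the polynomial algebra on `H` that sends the variable `x` to `⟪x, g⟫`. -/
noncomputable def dirDeriv (g : H) : Derivation ℝ (MvPolynomial H ℝ) (MvPolynomial H ℝ) :=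
  MvPolynomial.mkDerivation ℝ fun x => MvPolynomial.C ⟪x, g⟫

theorem IsIsonormal.memLp (hW : IsIsonormal W P) (x : H) (r : ℝ≥0∞) (hr : r ≠ ∞) :
    MemLp (W x) r P :=
  have := hW.gaussian.isProbabilityMeasure
  (hW.gaussian.hasGaussianLaw_eval x).memLp hr

theorem IsIsonormal.memLp_eval (hW : IsIsonormal W P) (p : MvPolynomial H ℝ) (r : ℝ≥0∞)
    (hr : r ≠ ∞) : MemLp (fun ω => MvPolynomial.eval (fun x => W x ω) p) r P :=
  have := hW.gaussian.isProbabilityMeasure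
  memLp_mvPolynomial_eval hW.memLp p r hr

theorem IsIsonormal.integrable_eval (hW : IsIsonormal W P) (p : MvPolynomial H ℝ) :
    Integrable (fun ω => MvPolynomial.eval (fun x => W x ω) p) P :=
  have := hW.gaussian.isProbabilityMeasure
  (hW.memLp_eval p 1 (by simp)).integrable le_rfl

theorem IsIsonormal.map_eq (hW : IsIsonormal W P) {g : H} (hg : ‖g‖ = 1) :
    P.map (W g) = gaussianReal 0 1 := by
  have := hW.gaussian.isProbabilityMeasure
  have hv : Var[W g; P] = 1 := by
    rw [variance_of_integral_eq_zero (hW.gaussian.aemeasurable g) (hW.centered g)]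
    have := hW.covariance g g
    rw [real_inner_self_eq_norm_sq, hg] at this
    simpa [pow_two] using this
  rw [(hW.gaussian.hasGaussianLaw_eval g).map_eq_gaussianReal, hv, hW.centered g]
  simp

/-- Residuals and `W g` are jointly Gaussian, so it suffices that they are uncorrelated: the
covariance is `⟪x, g⟫ - ⟪x, g⟫ ‖g‖² = 0`. -/
theorem IsIsonormal.indepFun_residual (hW : IsIsonormal W P) {g : H} (hg : ‖g‖ = 1) :
    IndepFun (fun ω x => W x ω - ⟪x, g⟫ * W g ω) (W g) P := by
  classical
  have := hW.gaussian.isProbabilityMeasure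
  have hm := hW.gaussian.aemeasurable
  have hG : IsGaussianProcess (Sum.elim (fun (x : H) ω => W x ω - ⟪x, g⟫ * W g ω)
      (fun (_ : Unit) => W g)) P := by
    refine hW.gaussian.of_isGaussianProcess ?_
    rintro (x | _)
    · refine ⟨{x, g}, ContinuousLinearMap.proj ⟨x, by simp⟩ -
        ⟪x, g⟫ • ContinuousLinearMap.proj ⟨g, by simp⟩, fun ω => ?_⟩
      simp
    · exact ⟨{g}, ContinuousLinearMap.proj ⟨g, by simp⟩, fun ω => by simp⟩
  have h2 := hG.indepFun_of_covariance_eq_zero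
    (fun x => (hm x).sub ((hm g).const_mul _)) (fun _ => hm g) (fun x _ => ?_)
  · exact h2.comp measurable_id (measurable_pi_apply ())
  · have i1 : ∀ x y : H, Integrable (fun ω => W x ω * W y ω) P := fun x y => by
      
      refine (hW.integrable_eval (MvPolynomial.X x * MvPolynomial.X y)).congr
        (.of_forall fun ω => ?_)
      simp
    rw [covariance_eq_sub, hW.centered g, mul_zero, sub_zero]
    · have : ∀ ω, ((fun ω => W x ω - ⟪x, g⟫ * W g ω) * W g) ω =
          W x ω * W g ω - ⟪x, g⟫ * (W g ω * W g ω) := fun ω => by simp; ring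
      simp only [this]
      rw [integral_sub (i1 _ _) ((i1 _ _).const_mul _), integral_const_mul, hW.covariance,
        hW.covariance, real_inner_self_eq_norm_sq, hg]
      simp
    · exact (hW.memLp x 2 (by simp)).sub ((hW.memLp g 2 (by simp)).const_mul _)
    · exact hW.memLp g 2 (by simp)

/-- Gaussian integration by parts for polynomials in an isonormal process. -/
theorem IsIsonormal.integral_mul_eval (hW : IsIsonormal W P) {g : H} (hg : ‖g‖ = 1)
    (p : MvPolynomial H ℝ) :
    ∫ ω, W g ω * MvPolynomial.eval (fun x => W x ω) p ∂P =
      ∫ ω, MvPolynomial.eval (fun x => W x ω) (dirDeriv g p) ∂P := by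
  have := hW.gaussian.isProbabilityMeasure
  have hm := hW.gaussian.aemeasurable
  -- Substitution `x ↦ x + ⟪x, g⟫ T`: with `T` evaluated at `W g` and `x` at its residual, it
  -- recovers `p(W)`.
  let φ : MvPolynomial H ℝ →ₐ[ℝ] Polynomial (MvPolynomial H ℝ) :=
    MvPolynomial.aeval fun x => Polynomial.C (MvPolynomial.X x) +
      Polynomial.C (MvPolynomial.C ⟪x, g⟫) * Polynomial.X
  have hφX : ∀ x, φ (MvPolynomial.X x) = Polynomial.C (MvPolynomial.X x) +
      Polynomial.C (MvPolynomial.C ⟪x, g⟫) * Polynomial.X := fun x => MvPolynomial.aeval_X _ _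
  have hφC : ∀ a : ℝ, φ (MvPolynomial.C a) = Polynomial.C (MvPolynomial.C a) := fun a =>
    MvPolynomial.aeval_C _ _
  have hφ : ∀ (p : MvPolynomial H ℝ) (ω : Ω), (φ p).eval₂
      (MvPolynomial.eval fun x => W x ω - ⟪x, g⟫ * W g ω) (W g ω) =
        MvPolynomial.eval (fun x => W x ω) p := by
    intro p ω
    induction p using MvPolynomial.induction_on with
    | C a => simp [hφC]
    | add p q hp hq => rw [map_add, Polynomial.eval₂_add, hp, hq, map_add]
    | mul_X p x hp =>
      rw [map_mul, Polynomial.eval₂_mul, hp, map_mul, hφX]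
      simp [Polynomial.eval₂_add, Polynomial.eval₂_mul]
  -- Under the substitution, `d/dT` becomes the directional derivative along `g`.
  have hφd : ∀ p : MvPolynomial H ℝ, (φ p).derivative = φ (dirDeriv g p) := by
    intro p
    induction p using MvPolynomial.induction_on with
    | C a => simp [hφC, dirDeriv]
    | add p q hp hq => simp only [map_add, hp, hq]
    | mul_X p x hp =>
      rw [Derivation.leibniz, map_mul, Polynomial.derivative_mul, hp, hφX]
      simp [dirDeriv, hφX, hφC, smul_eq_mul]
      ring
  have h := (integral_mul_eval₂_of_indepFun (P := P)
    (Y := fun x ω => W x ω - ⟪x, g⟫ * W g ω) (Z := W g)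
    (fun x r hr => (hW.memLp x r hr).sub ((hW.memLp g r hr).const_mul _))
    (hm g) (hW.map_eq hg)
    (hW.indepFun_residual hg) (φ p))
  simpa only [hφd, hφ] using h

end Isonormal

/-! ### Hermite polynomials and their orthogonality -/

section Hermite

/-- The probabilists' Hermite polynomial with real coefficients. -/
noncomputable def hermiteReal (n : ℕ) : Polynomial ℝ :=
  (Polynomial.hermite n).map (Int.castRingHom ℝ)

theorem aeval_hermite_eq_eval (n : ℕ) (x : ℝ) :
    Polynomial.aeval x (Polynomial.hermite n) = (hermiteReal n).eval x := by
  rw [hermiteReal, Polynomial.eval_map, Polynomial.aeval_def]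
  rfl

theorem hermiteReal_zero : hermiteReal 0 = 1 := by simp [hermiteReal]

theorem hermiteReal_succ (n : ℕ) : hermiteReal (n + 1) =
    Polynomial.X * hermiteReal n - Polynomial.derivative (hermiteReal n) := by
  simp [hermiteReal, Polynomial.hermite_succ, Polynomial.derivative_map]

theorem hermiteReal_monic (n : ℕ) : (hermiteReal n).Monic :=
  (Polynomial.hermite_monic n).map _

theorem natDegree_hermiteReal (n : ℕ) : (hermiteReal n).natDegree = n := by
  rw [hermiteReal, (Polynomial.hermite_monic n).natDegree_map, Polynomial.natDegree_hermite]

theorem iterate_derivative_hermiteReal_self (n : ℕ) :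
    Polynomial.derivative^[n] (hermiteReal n) = Polynomial.C (n.factorial : ℝ) := by
  have h := Polynomial.natDegree_iterate_derivative (hermiteReal n) n
  rw [natDegree_hermiteReal, Nat.sub_self, Nat.le_zero] at h
  rw [Polynomial.eq_C_of_natDegree_eq_zero h, Polynomial.coeff_iterate_derivative]
  have h1 : (hermiteReal n).coeff n = 1 := by
    have := (hermiteReal_monic n).coeff_natDegree
    rwa [natDegree_hermiteReal] at this
  simp [h1, Nat.descFactorial_self]

variable {Ω : Type*} [MeasurableSpace Ω] {P : Measure Ω} {H : Type*} [NormedAddCommGroup H]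
  [InnerProductSpace ℝ H] {W : H → Ω → ℝ}

theorem IsIsonormal.memLp_polynomial_eval (hW : IsIsonormal W P) (h : H) (q : Polynomial ℝ)
    (r : ℝ≥0∞) (hr : r ≠ ∞) : MemLp (fun ω => q.eval (W h ω)) r P := by
  have := hW.memLp_eval (Polynomial.aeval (MvPolynomial.X h) q) r hr
  simpa only [mvPolynomial_eval_aeval, MvPolynomial.eval_X] using! this

/-- In `Hₙ₊₁ = X Hₙ - Hₙ'`, integrating the factor `W h` by parts produces a term with `Hₙ'` that
cancels the subtracted one; only the derivative falling on `q` survives. -/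
theorem IsIsonormal.integral_hermiteReal_succ_mul (hW : IsIsonormal W P) {h : H} (hh : ‖h‖ = 1)
    (k : H) (n : ℕ) (q : Polynomial ℝ) :
    ∫ ω, (hermiteReal (n + 1)).eval (W h ω) * q.eval (W k ω) ∂P =
      ⟪h, k⟫ * ∫ ω, (hermiteReal n).eval (W h ω) * q.derivative.eval (W k ω) ∂P := by
  have := hW.gaussian.isProbabilityMeasure
  have hi : ∀ u v : Polynomial ℝ, Integrable (fun ω => u.eval (W h ω) * v.eval (W k ω)) P :=
    fun u v => (memLp_mul_of_forall (hW.memLp_polynomial_eval h u)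
      (hW.memLp_polynomial_eval k v) 1 (by simp)).integrable le_rfl
  have hs := hW.integral_mul_eval hh (Polynomial.aeval (MvPolynomial.X h) (hermiteReal n) *
    Polynomial.aeval (MvPolynomial.X k) q)
  simp only [Derivation.leibniz, Derivation.map_aeval, dirDeriv, MvPolynomial.mkDerivation_X,
    map_add, map_mul, smul_eq_mul, mvPolynomial_eval_aeval, MvPolynomial.eval_X,
    MvPolynomial.eval_C, real_inner_self_eq_norm_sq, hh] at hs
  rw [real_inner_comm] at hs
  have e1 : ∀ ω, (hermiteReal (n + 1)).eval (W h ω) * q.eval (W k ω) =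
      W h ω * ((hermiteReal n).eval (W h ω) * q.eval (W k ω)) -
        (hermiteReal n).derivative.eval (W h ω) * q.eval (W k ω) := fun ω => by
    rw [hermiteReal_succ]; simp; ring
  have e2 : ∀ ω, (hermiteReal n).eval (W h ω) * (q.derivative.eval (W k ω) * ⟪h, k⟫) +
      q.eval (W k ω) * ((hermiteReal n).derivative.eval (W h ω) * 1 ^ 2) =
      ⟪h, k⟫ * ((hermiteReal n).eval (W h ω) * q.derivative.eval (W k ω)) +
        (hermiteReal n).derivative.eval (W h ω) * q.eval (W k ω) := fun ω => by ring
  have hi2 : Integrable (fun ω => W h ω * ((hermiteReal n).eval (W h ω) * q.eval (W k ω))) P := by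
    refine (hi (Polynomial.X * hermiteReal n) q).congr (.of_forall fun ω => ?_)
    simp [mul_assoc]
  simp only [e2] at hs
  rw [integral_add ((hi _ _).const_mul _) (hi _ _), integral_const_mul] at hs
  simp only [e1]
  rw [integral_sub hi2 (hi _ _), hs]
  ring

theorem IsIsonormal.integral_hermiteReal_mul (hW : IsIsonormal W P) {h : H} (hh : ‖h‖ = 1)
    (k : H) (n : ℕ) (q : Polynomial ℝ) :
    ∫ ω, (hermiteReal n).eval (W h ω) * q.eval (W k ω) ∂P =
      ⟪h, k⟫ ^ n * ∫ ω, (Polynomial.derivative^[n] q).eval (W k ω) ∂P := by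
  induction n generalizing q with
  | zero => simp [hermiteReal_zero]
  | succ n ih =>
    rw [hW.integral_hermiteReal_succ_mul hh, ih, Function.iterate_succ_apply]
    ring

theorem IsIsonormal.integral_hermiteReal_mul_hermiteReal (hW : IsIsonormal W P) {h : H}
    (hh : ‖h‖ = 1) (k : H) (n : ℕ) :
    ∫ ω, (hermiteReal n).eval (W h ω) * (hermiteReal n).eval (W k ω) ∂P =
      n.factorial * ⟪h, k⟫ ^ n := by
  have := hW.gaussian.isProbabilityMeasure
  rw [hW.integral_hermiteReal_mul hh, iterate_derivative_hermiteReal_self]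
  simp [mul_comm]

/-- The factor of higher order puts more derivatives on the other polynomial than its degree allows.
-/
theorem IsIsonormal.integral_hermiteReal_mul_of_ne (hW : IsIsonormal W P) {h : H}
    (hh : ‖h‖ = 1) {n m : ℕ} (hnm : n ≠ m) :
    ∫ ω, (hermiteReal n).eval (W h ω) * (hermiteReal m).eval (W h ω) ∂P = 0 := by
  wlog hlt : m < n generalizing n m
  · simpa only [mul_comm] using this hnm.symm (by omega)
  rw [hW.integral_hermiteReal_mul hh, Polynomial.iterate_derivative_eq_zero
    (by rwa [natDegree_hermiteReal])]
  simp

theorem IsIsonormal.integral_hermiteReal (hW : IsIsonormal W P) {h : H}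
    (hh : ‖h‖ = 1) {n : ℕ} (hn : n ≠ 0) : ∫ ω, (hermiteReal n).eval (W h ω) ∂P = 0 := by
  simpa [hermiteReal_zero] using hW.integral_hermiteReal_mul_of_ne hh hn

end Hermite

/-- The identity cuts out the kernel of a continuous linear functional, a closed subspace. This
carries identities checked on generators over to closed graphs. -/
theorem inner_snd_eq_of_mem_topologicalClosure_span {E F : Type*} [NormedAddCommGroup E]
    [InnerProductSpace ℝ E] [NormedAddCommGroup F] [InnerProductSpace ℝ F] {S : Set (E × F)}
    (a : E) (b : F) (hS : ∀ q ∈ S, ⟪b, q.2⟫ = ⟪a, q.1⟫) {q : E × F}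
    (hq : q ∈ (Submodule.span ℝ S).topologicalClosure) : ⟪b, q.2⟫ = ⟪a, q.1⟫ := by
  let L : E × F →L[ℝ] ℝ := (innerSL ℝ b) ∘L (ContinuousLinearMap.snd ℝ E F) -
    (innerSL ℝ a) ∘L (ContinuousLinearMap.fst ℝ E F)
  have hle : (Submodule.span ℝ S).topologicalClosure ≤ LinearMap.ker (L : E × F →ₗ[ℝ] ℝ) := by
    refine Submodule.topologicalClosure_minimal _ (Submodule.span_le.2 fun q hq => ?_) L.isClosed_ker
    simpa [L, sub_eq_zero] using hS q hq
  have := hle hq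
  simpa [L, sub_eq_zero] using this

/-! ### The multiple integral on tensor powers -/

section MultipleIntegral

variable {Ω : Type*} [MeasurableSpace Ω] {P : Measure Ω} {H : Type*} [NormedAddCommGroup H]
  [InnerProductSpace ℝ H] {W : H → Ω → ℝ}

theorem IsIsonormal.inner_of_mem_multipleIntegralGraph (hW : IsIsonormal W P) {n : ℕ}
    {q r : HilbertTensorPower H n × Lp ℝ 2 P} (hq : q ∈ multipleIntegralGraph W P n)
    (hr : r ∈ multipleIntegralGraph W P n) : ⟪q.2, r.2⟫ = n.factorial * ⟪q.1, r.1⟫ := by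
  have key : ∀ h : H, ‖h‖ = 1 → ∀ F : Lp ℝ 2 P,
      (F =ᵐ[P] fun ω => Polynomial.aeval (W h ω) (Polynomial.hermite n)) →
      ∀ r ∈ multipleIntegralGraph W P n,
        ⟪F, r.2⟫ = ⟪(n.factorial : ℝ) • tensorPow n h, r.1⟫ := by
    intro h hh F hF r hr
    refine inner_snd_eq_of_mem_topologicalClosure_span _ _ ?_ hr
    rintro ⟨t, G⟩ ⟨k, hk, ht, hG⟩
    simp only at ht hG
    rw [ht, inner_smul_left, inner_tensorPow, L2.inner_def]
    have := hW.integral_hermiteReal_mul_hermiteReal hh k n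
    simp only [conj_trivial]
    rw [← this]
    refine integral_congr_ae ?_
    filter_upwards [hF, hG] with ω h1 h2
    rw [h1, h2, aeval_hermite_eq_eval, aeval_hermite_eq_eval]
    simp [mul_comm]
  -- Second extension: `key` has passed to the closure in `r` for a fixed generator; now `r` is
  -- fixed and `q` passes to the closure.
  have h2 := inner_snd_eq_of_mem_topologicalClosure_span ((n.factorial : ℝ) • r.1) r.2 ?_ hq
  · rw [real_inner_comm, h2, real_inner_smul_left, real_inner_comm]
  · rintro ⟨t, G⟩ ⟨k, hk, ht, hG⟩
    simp only at ht hG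
    rw [real_inner_comm, key k hk G hG r hr, ht, real_inner_smul_left, real_inner_smul_left,
      real_inner_comm]

/-- The chosen value and the Hermite value differ by a graph element with first component `0`; by
the isometry its second component has norm `0`. -/
theorem IsIsonormal.multipleIntegral_tensorPow (hW : IsIsonormal W P) {h : H} (hh : ‖h‖ = 1)
    (n : ℕ) : multipleIntegral W P n (tensorPow n h) =ᵐ[P]
      fun ω => (hermiteReal n).eval (W h ω) := by
  have hm := hW.memLp_polynomial_eval h (hermiteReal n) 2 (by simp)
  have hmem : (tensorPow n h, hm.toLp) ∈ multipleIntegralGraph W P n := by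
    refine Submodule.le_topologicalClosure _ (Submodule.subset_span ⟨h, hh, rfl, ?_⟩)
    filter_upwards [hm.coeFn_toLp] with ω hω
    rw [hω, aeval_hermite_eq_eval]
  have hex : ∃ F, (tensorPow n h, F) ∈ multipleIntegralGraph W P n := ⟨_, hmem⟩
  have hsub := Submodule.sub_mem _ hex.choose_spec hmem
  have h0 := hW.inner_of_mem_multipleIntegralGraph hsub hsub
  simp only [Prod.fst_sub, Prod.snd_sub, sub_self, inner_zero_left, mul_zero,
    inner_self_eq_zero, sub_eq_zero] at h0
  rw [multipleIntegral, dif_pos hex, h0]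
  exact hm.coeFn_toLp

end MultipleIntegral

/-! ### Closability of the Malliavin derivative -/

section Malliavin

variable {Ω : Type*} [MeasurableSpace Ω] {P : Measure Ω} {H : Type*} [NormedAddCommGroup H]
  [InnerProductSpace ℝ H] {W : H → Ω → ℝ}

/-- Identifies `dirDeriv g` with the pairing of the cylindrical gradient with `g`, so that
integration by parts applies to `D`. -/
theorem dirDeriv_rename {k : ℕ} (g : H) (x : Fin k → H) (p : MvPolynomial (Fin k) ℝ) :
    dirDeriv g (MvPolynomial.rename x p) =
      ∑ i, MvPolynomial.C ⟪x i, g⟫ * MvPolynomial.rename x (MvPolynomial.pderiv i p) := by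
  induction p using MvPolynomial.induction_on with
  | C a => simp [dirDeriv]
  | add p q hp hq => simp only [map_add, hp, hq, mul_add, Finset.sum_add_distrib]
  | mul_X p j hp =>
    simp only [map_mul, MvPolynomial.rename_X, Derivation.leibniz, hp, MvPolynomial.pderiv_X,
      map_add, smul_eq_mul, mul_add, Finset.sum_add_distrib]
    congr 1
    · simp [dirDeriv, Pi.single_apply, apply_ite (MvPolynomial.rename x), mul_comm]
    · rw [Finset.mul_sum]
      exact Finset.sum_congr rfl fun i _ => by ring

theorem IsIsonormal.memLp_eval_smul (hW : IsIsonormal W P) (p : MvPolynomial H ℝ) (g : H) :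
    MemLp (fun ω => MvPolynomial.eval (fun x => W x ω) p • g) 2 P := by
  have h := hW.memLp_eval p 2 (by simp)
  refine MemLp.of_le_mul (c := ‖g‖) h (h.aestronglyMeasurable.smul_const g)
    (.of_forall fun ω => ?_)
  rw [norm_smul, mul_comm]

/-- The duality between the Malliavin derivative and multiplication by `W g`. -/
theorem IsIsonormal.inner_of_mem_malliavinGraph (hW : IsIsonormal W P) {g : H} (hg : ‖g‖ = 1)
    (p : MvPolynomial H ℝ) {q : Lp ℝ 2 P × Lp H 2 P} (hq : q ∈ malliavinGraph W P) :
    ⟪(hW.memLp_eval_smul p g).toLp, q.2⟫ =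
      ⟪(hW.memLp_eval (MvPolynomial.X g * p - dirDeriv g p) 2 (by simp)).toLp, q.1⟫ := by
  refine inner_snd_eq_of_mem_topologicalClosure_span _ _ ?_ hq
  rintro ⟨F, U⟩ ⟨k, x, u, hF, hU⟩
  simp only at hF hU
  rw [L2.inner_def, L2.inner_def]
  have hu : ∀ (v : MvPolynomial (Fin k) ℝ) ω, MvPolynomial.eval (fun i => W (x i) ω) v =
      MvPolynomial.eval (fun x => W x ω) (MvPolynomial.rename x v) := fun v ω => by
    rw [MvPolynomial.eval_rename]; rfl
  have e1 : ∫ ω, ⟪((hW.memLp_eval_smul p g).toLp : Lp H 2 P) ω, U ω⟫ ∂P =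
      ∫ ω, MvPolynomial.eval (fun x => W x ω)
        (p * dirDeriv g (MvPolynomial.rename x u)) ∂P := by
    refine integral_congr_ae ?_
    filter_upwards [(hW.memLp_eval_smul p g).coeFn_toLp, hU] with ω h1 h2
    rw [h1, h2, dirDeriv_rename, inner_smul_left, inner_sum]
    simp only [inner_smul_right, map_mul, map_sum, hu, MvPolynomial.eval_C, conj_trivial]
    congr 1
    exact Finset.sum_congr rfl fun i _ => by rw [real_inner_comm, mul_comm]
  have e2 : ∫ ω, ⟪((hW.memLp_eval (MvPolynomial.X g * p - dirDeriv g p) 2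
      (by simp)).toLp : Lp ℝ 2 P) ω, F ω⟫ ∂P =
      ∫ ω, (W g ω * MvPolynomial.eval (fun x => W x ω) (p * MvPolynomial.rename x u) -
        MvPolynomial.eval (fun x => W x ω) (dirDeriv g p * MvPolynomial.rename x u)) ∂P := by
    refine integral_congr_ae ?_
    filter_upwards [(hW.memLp_eval (MvPolynomial.X g * p - dirDeriv g p) 2 (by simp)).coeFn_toLp,
      hF] with ω h1 h2
    rw [h1, h2, hu]
    simp
    ring
  have hi : Integrable (fun ω => W g ω *
      MvPolynomial.eval (fun x => W x ω) (p * MvPolynomial.rename x u)) P := by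
    refine (hW.integrable_eval (MvPolynomial.X g * (p * MvPolynomial.rename x u))).congr
      (.of_forall fun ω => ?_)
    simp
  rw [e1, e2, integral_sub hi (hW.integrable_eval _), hW.integral_mul_eval hg,
    ← integral_sub (hW.integrable_eval _) (hW.integrable_eval _)]
  congr 1
  ext ω
  rw [← map_sub]
  congr 1
  rw [Derivation.leibniz]
  simp only [smul_eq_mul]
  ring

/-- By duality `U` is orthogonal to every field `p(W) g`. Since `U` is itself a limit of sums of
such fields, it is orthogonal to itself; density of polynomials in `L²(P)` is not needed. -/
theorem IsIsonormal.eq_zero_of_mem_malliavinGraph (hW : IsIsonormal W P) {U : Lp H 2 P}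
    (hU : (0, U) ∈ malliavinGraph W P) : U = 0 := by
  have h1 : ∀ (g : H) (p : MvPolynomial H ℝ),
      ∫ ω, MvPolynomial.eval (fun x => W x ω) p * ⟪g, U ω⟫ ∂P = 0 := by
    intro g p
    rcases eq_or_ne g 0 with rfl | hg
    · simp
    have hg' : ‖g‖ ≠ 0 := norm_ne_zero_iff.2 hg
    -- The duality is available for unit vectors only.
    have hn : ‖‖g‖⁻¹ • g‖ = 1 := by rw [norm_smul, norm_inv, norm_norm, inv_mul_cancel₀ hg']
    have h := hW.inner_of_mem_malliavinGraph hn p hU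
    rw [inner_zero_right, L2.inner_def] at h
    have h2 : ∫ ω, ‖g‖⁻¹ * (MvPolynomial.eval (fun x => W x ω) p * ⟪g, U ω⟫) ∂P = 0 := by
      rw [← h]
      refine integral_congr_ae ?_
      filter_upwards [(hW.memLp_eval_smul p (‖g‖⁻¹ • g)).coeFn_toLp] with ω hω
      rw [hω, real_inner_smul_left, real_inner_smul_left]
      ring
    rw [integral_const_mul] at h2
    exact (mul_eq_zero.1 h2).resolve_left (inv_ne_zero hg')
  -- Orthogonality to `U` extends from the generators to the whole graph, then is tested on `(0,
  -- U)`.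
  have h2 := inner_snd_eq_of_mem_topologicalClosure_span (0 : Lp ℝ 2 P) U ?_ hU
  · simpa using h2
  rintro ⟨F, V⟩ ⟨k, x, u, hF, hV⟩
  simp only at hF hV
  rw [inner_zero_left, L2.inner_def]
  have e : ∫ ω, ⟪U ω, V ω⟫ ∂P = ∫ ω, ∑ i, MvPolynomial.eval (fun x => W x ω)
      (MvPolynomial.rename x (MvPolynomial.pderiv i u)) * ⟪x i, U ω⟫ ∂P := by
    refine integral_congr_ae ?_
    filter_upwards [hV] with ω h
    rw [h, inner_sum]
    refine Finset.sum_congr rfl fun i _ => ?_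
    rw [inner_smul_right, real_inner_comm, MvPolynomial.eval_rename]
    rfl
  rw [e, integral_finsetSum]
  · exact Finset.sum_eq_zero fun i _ => h1 _ _
  · intro i _
    refine (L2.integrable_inner (𝕜 := ℝ) (hW.memLp_eval_smul (MvPolynomial.rename x
      (MvPolynomial.pderiv i u)) (x i)).toLp U).congr ?_
    filter_upwards [(hW.memLp_eval_smul (MvPolynomial.rename x
      (MvPolynomial.pderiv i u)) (x i)).coeFn_toLp] with ω hω
    rw [hω, real_inner_smul_left]

theorem IsIsonormal.mem_malliavinGraph_polynomial (hW : IsIsonormal W P) (h : H)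
    (q : Polynomial ℝ) {F : Lp ℝ 2 P} (hF : F =ᵐ[P] fun ω => q.eval (W h ω)) :
    ∃ U : Lp H 2 P, (U =ᵐ[P] fun ω => q.derivative.eval (W h ω) • h) ∧
      (F, U) ∈ malliavinGraph W P := by
  have hm := hW.memLp_eval_smul (Polynomial.aeval (MvPolynomial.X h) q.derivative) h
  have hU : hm.toLp =ᵐ[P] fun ω => q.derivative.eval (W h ω) • h := by
    filter_upwards [hm.coeFn_toLp] with ω hω
    rw [hω, mvPolynomial_eval_aeval, MvPolynomial.eval_X]
  refine ⟨hm.toLp, hU, Submodule.le_topologicalClosure _ (Submodule.subset_span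
    ⟨1, fun _ => h, Polynomial.aeval (MvPolynomial.X 0) q, ?_, ?_⟩)⟩
  · filter_upwards [hF] with ω hω
    rw [hω, mvPolynomial_eval_aeval, MvPolynomial.eval_X]
  · filter_upwards [hU] with ω hω
    rw [hω]
    simp [Derivation.map_aeval, mvPolynomial_eval_aeval]

theorem IsIsonormal.isMalliavinDifferentiable_polynomial (hW : IsIsonormal W P) (h : H)
    (q : Polynomial ℝ) {F : Lp ℝ 2 P} (hF : F =ᵐ[P] fun ω => q.eval (W h ω)) :
    IsMalliavinDifferentiable W P F :=
  let ⟨U, _, hU⟩ := hW.mem_malliavinGraph_polynomial h q hF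
  ⟨U, hU⟩

theorem IsIsonormal.malliavinDeriv_polynomial (hW : IsIsonormal W P) (h : H)
    (q : Polynomial ℝ) {F : Lp ℝ 2 P} (hF : F =ᵐ[P] fun ω => q.eval (W h ω)) :
    malliavinDeriv W P F =ᵐ[P] fun ω => q.derivative.eval (W h ω) • h := by
  obtain ⟨U, hU, hmem⟩ := hW.mem_malliavinGraph_polynomial h q hF
  have hex : IsMalliavinDifferentiable W P F := ⟨U, hmem⟩
  have hsub := Submodule.sub_mem _ hex.choose_spec hmem
  rw [Prod.mk_sub_mk, sub_self] at hsub
  rw [malliavinDeriv, dif_pos hex, sub_eq_zero.1 (hW.eq_zero_of_mem_malliavinGraph hsub)]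
  exact hU

end Malliavin

/-- The curve is a continuous image of `ℝ`, hence σ-compact. As `p` is nonconstant, it takes each
value finitely often, so every vertical slice is finite and Fubini gives measure zero. -/
theorem measurableSet_and_volume_range_polynomial_curve {p : Polynomial ℝ} (hp : 0 < p.natDegree)
    (q : Polynomial ℝ) :
    MeasurableSet (Set.range fun t : ℝ => (p.eval t, q.eval t)) ∧
      (volume : Measure (ℝ × ℝ)) (Set.range fun t : ℝ => (p.eval t, q.eval t)) = 0 := by
  have hc : Continuous fun t : ℝ => (p.eval t, q.eval t) := p.continuous.prodMk q.continuous
  have hm : MeasurableSet (Set.range fun t : ℝ => (p.eval t, q.eval t)) := by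
    obtain ⟨K, hK, hU⟩ := isSigmaCompact_range hc
    rw [← hU]
    exact MeasurableSet.iUnion fun n => (hK n).measurableSet
  refine ⟨hm, ?_⟩
  rw [Measure.volume_eq_prod, Measure.measure_prod_null hm]
  refine .of_forall fun x => ?_
  have hne : p - Polynomial.C x ≠ 0 := by
    intro h0
    rw [sub_eq_zero.1 h0] at hp
    simp at hp
  have hfin : {t : ℝ | p.eval t = x}.Finite := by
    refine (p - Polynomial.C x).roots.toFinset.finite_toSet.subset fun t ht => ?_
    have : p.eval t = x := ht
    simp [hne, this]
  refine Set.Finite.measure_zero ((hfin.image fun t => q.eval t).subset ?_) _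
  rintro y ⟨t, ht⟩
  simp only [Prod.mk.injEq] at ht
  exact ⟨t, ht.1, ht.2⟩

/-! ### The vector of two Hermite polynomials of `W h` -/

section HermiteVector

variable {Ω : Type*} [MeasurableSpace Ω] {P : Measure Ω} {H : Type*} [NormedAddCommGroup H]
  [InnerProductSpace ℝ H] {W : H → Ω → ℝ} {F G : Lp ℝ 2 P}

theorem IsIsonormal.det_malliavinMatrix_polynomial (hW : IsIsonormal W P) (h : H)
    {p q : Polynomial ℝ} (hF : F =ᵐ[P] fun ω => p.eval (W h ω))
    (hG : G =ᵐ[P] fun ω => q.eval (W h ω)) :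
    ∀ᵐ ω ∂P, (malliavinMatrix W P F G ω).det = 0 := by
  filter_upwards [hW.malliavinDeriv_polynomial h p hF, hW.malliavinDeriv_polynomial h q hG]
    with ω h1 h2
  rw [malliavinMatrix, Matrix.det_fin_two_of, h1, h2]
  simp only [real_inner_smul_left, real_inner_smul_right]
  ring

theorem IsIsonormal.covariance_hermiteReal (hW : IsIsonormal W P) {h : H} (hh : ‖h‖ = 1)
    {n m : ℕ} (hn : n ≠ 0)
    (hF : F =ᵐ[P] fun ω => (hermiteReal n).eval (W h ω))
    (hG : G =ᵐ[P] fun ω => (hermiteReal m).eval (W h ω)) :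
    cov[F, G; P] = if n = m then (n.factorial : ℝ) else 0 := by
  have := hW.gaussian.isProbabilityMeasure
  -- The product of the means vanishes once `F` is centered, so `m = 0` is harmless here.
  rw [covariance_eq_sub (Lp.memLp F) (Lp.memLp G), integral_congr_ae hF,
    hW.integral_hermiteReal hh hn, integral_congr_ae (hF.mul hG), zero_mul, sub_zero]
  split_ifs with hnm
  · subst hnm
    have := hW.integral_hermiteReal_mul_hermiteReal hh h n
    rw [real_inner_self_eq_norm_sq, hh] at this
    simpa using! this
  · exact hW.integral_hermiteReal_mul_of_ne hh hnm

theorem IsIsonormal.det_covMatrix_hermiteReal (hW : IsIsonormal W P) {h : H} (hh : ‖h‖ = 1)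
    {n m : ℕ} (hn : n ≠ 0) (hm : m ≠ 0) (hnm : n ≠ m)
    (hF : F =ᵐ[P] fun ω => (hermiteReal n).eval (W h ω))
    (hG : G =ᵐ[P] fun ω => (hermiteReal m).eval (W h ω)) :
    (covMatrix P F G).det = n.factorial * m.factorial := by
  rw [covMatrix, Matrix.det_fin_two_of, hW.covariance_hermiteReal hh hn hF hF,
    hW.covariance_hermiteReal hh hn hF hG, hW.covariance_hermiteReal hh hm hG hG]
  simp [hnm]

theorem not_hasJointDensity_polynomial [IsProbabilityMeasure P] {Z : Ω → ℝ} {p q : Polynomial ℝ}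
    (hp : 0 < p.natDegree) (hF : F =ᵐ[P] fun ω => p.eval (Z ω))
    (hG : G =ᵐ[P] fun ω => q.eval (Z ω)) : ¬ HasJointDensity P F G := by
  intro hd
  obtain ⟨hms, h0⟩ := measurableSet_and_volume_range_polynomial_curve hp q
  have h1 := hd h0
  rw [Measure.map_apply_of_aemeasurable
    ((Lp.aestronglyMeasurable F).aemeasurable.prodMk (Lp.aestronglyMeasurable G).aemeasurable)
    hms] at h1
  have h2 : ∀ᵐ ω ∂P, (F ω, G ω) ∈ Set.range fun t : ℝ => (p.eval t, q.eval t) := by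
    filter_upwards [hF, hG] with ω h3 h4
    exact ⟨Z ω, by rw [h3, h4]⟩
  have h3 : ∀ᵐ _ ∂P, False := by
    filter_upwards [h2, measure_eq_zero_iff_ae_notMem.1 h1] with ω h4 h5
    exact h5 h4
  -- A probability measure is nonzero, so an almost sure contradiction is a contradiction.
  exact h3.exists.elim fun _ => id

/-- `F` and `G` are nonzero orthogonal vectors of `L²(P)`: pairing a relation with each of them
kills both coefficients. -/
theorem IsIsonormal.not_areProportional_hermiteReal (hW : IsIsonormal W P) {h : H}
    (hh : ‖h‖ = 1) {n m : ℕ} (hnm : n ≠ m)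
    (hF : F =ᵐ[P] fun ω => (hermiteReal n).eval (W h ω))
    (hG : G =ᵐ[P] fun ω => (hermiteReal m).eval (W h ω)) : ¬ AreProportional P F G := by
  have hself : ∀ {n : ℕ} {F : Lp ℝ 2 P}, (F =ᵐ[P] fun ω => (hermiteReal n).eval (W h ω)) →
      ⟪F, F⟫ = (n.factorial : ℝ) := by
    intro n F hF
    have h1 := hW.integral_hermiteReal_mul_hermiteReal hh h n
    rw [real_inner_self_eq_norm_sq, hh, one_pow, one_pow, mul_one] at h1
    rw [L2.inner_def, ← h1]
    refine integral_congr_ae ?_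
    filter_upwards [hF] with ω h2
    rw [h2, real_inner_self_eq_norm_mul_norm]
    simp
  have hne : ⟪F, G⟫ = 0 := by
    rw [L2.inner_def, ← hW.integral_hermiteReal_mul_of_ne hh hnm]
    refine integral_congr_ae ?_
    filter_upwards [hF, hG] with ω h2 h3
    rw [h2, h3]
    simp [mul_comm]
  rintro ⟨a, b, hab, h0⟩
  have ha : ⟪F, a • F + b • G⟫ = 0 := by rw [h0, inner_zero_right]
  have hb : ⟪G, a • F + b • G⟫ = 0 := by rw [h0, inner_zero_right]
  rw [inner_add_right, inner_smul_right, inner_smul_right, hself hF, hne] at ha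
  rw [inner_add_right, inner_smul_right, inner_smul_right, hself hG, real_inner_comm, hne] at hb
  have hn0 : (n.factorial : ℝ) ≠ 0 := by positivity
  have hm0 : (m.factorial : ℝ) ≠ 0 := by positivity
  rcases hab with h | h
  · exact h (by simpa [hn0] using ha)
  · exact h (by simpa [hm0] using hb)

end HermiteVector

end WienerChaos

theorem mainTheorem7 {Ω : Type*} [MeasurableSpace Ω] (P : MeasureTheory.Measure Ω)
    [MeasureTheory.IsProbabilityMeasure P]
    {H : Type*} [NormedAddCommGroup H] [InnerProductSpace ℝ H] [CompleteSpace H]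
    (W : H → Ω → ℝ) (hW : WienerChaos.IsIsonormal W P) (h : H) (hh : ‖h‖ = 1) :
    (∀ F G : MeasureTheory.Lp ℝ 2 P,
      F = WienerChaos.multipleIntegral W P 1 (WienerChaos.tensorPow 1 h) →
      G = WienerChaos.multipleIntegral W P 2 (WienerChaos.tensorPow 2 h) →
      (WienerChaos.covMatrix P F G).det = 2 ∧
      ∀ᵐ ω ∂P, (WienerChaos.malliavinMatrix W P F G ω).det = 0) ∧
    ∀ n m : ℕ, 1 ≤ n → 1 ≤ m → n ≠ m →
      ∀ F G : MeasureTheory.Lp ℝ 2 P,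
      F = WienerChaos.multipleIntegral W P n (WienerChaos.tensorPow n h) →
      G = WienerChaos.multipleIntegral W P m (WienerChaos.tensorPow m h) →
      WienerChaos.IsMalliavinDifferentiable W P F ∧
      WienerChaos.IsMalliavinDifferentiable W P G ∧
      (∀ᵐ ω ∂P, (WienerChaos.malliavinMatrix W P F G ω).det = 0) ∧
      (WienerChaos.covMatrix P F G).det = (n.factorial : ℝ) * (m.factorial : ℝ) ∧
      (WienerChaos.covMatrix P F G).det ≠ 0 ∧
      ¬ WienerChaos.HasJointDensity P F G ∧
      ¬ WienerChaos.AreProportional P F G := by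
  have key : ∀ n m : ℕ, 1 ≤ n → 1 ≤ m → n ≠ m → ∀ F G : MeasureTheory.Lp ℝ 2 P,
      F = WienerChaos.multipleIntegral W P n (WienerChaos.tensorPow n h) →
      G = WienerChaos.multipleIntegral W P m (WienerChaos.tensorPow m h) →
      WienerChaos.IsMalliavinDifferentiable W P F ∧
      WienerChaos.IsMalliavinDifferentiable W P G ∧
      (∀ᵐ ω ∂P, (WienerChaos.malliavinMatrix W P F G ω).det = 0) ∧
      (WienerChaos.covMatrix P F G).det = (n.factorial : ℝ) * (m.factorial : ℝ) ∧
      (WienerChaos.covMatrix P F G).det ≠ 0 ∧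
      ¬ WienerChaos.HasJointDensity P F G ∧
      ¬ WienerChaos.AreProportional P F G := by
    rintro n m hn hm hnm F G rfl rfl
    have hF := hW.multipleIntegral_tensorPow hh n
    have hG := hW.multipleIntegral_tensorPow hh m
    have hdet := hW.det_covMatrix_hermiteReal hh (by omega) (by omega) hnm hF hG
    refine ⟨hW.isMalliavinDifferentiable_polynomial h _ hF,
      hW.isMalliavinDifferentiable_polynomial h _ hG, hW.det_malliavinMatrix_polynomial h hF hG,
      hdet, ?_, WienerChaos.not_hasJointDensity_polynomial ?_ hF hG,
      hW.not_areProportional_hermiteReal hh hnm hF hG⟩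
    · rw [hdet]
      positivity
    · rw [WienerChaos.natDegree_hermiteReal]
      exact hn
  refine ⟨fun F G hF hG => ?_, key⟩
  obtain ⟨-, -, hL, hC, -⟩ := key 1 2 (by norm_num) (by norm_num) (by norm_num) F G hF hG
  exact ⟨by rw [hC]; norm_num [Nat.factorial], hL⟩
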